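/- Let $\mathbb{F}$ be an algebraically closed field (of arbitrary characteristic), and let $\mathfrak{L}$ be a finite-dimensional left Leibniz algebra over $\mathbb{F}$, that is, a finite-dimensional $\mathbb{F}$-vector space with an $\mathbb{F}$-bilinear multiplication satisfying $x(yz)=(xy)z+y(xz)$ for all $x,y,z\in\mathfrak{L}$. Call $\mathfrak{L}$ supersolvable if there exists a chain $\mathfrak{L}=\mathfrak{L}_k\supset\mathfrak{L}_{k-1}\supset\cdots\supset\mathfrak{L}_1\supset\mathfrak{L}_0=0$ of two-sided ideals of $\mathfrak{L}$ such that $\dim_{\mathbb{F}}\mathfrak{L}_j/\mathfrak{L}_{j-1}=1$ for every integer $1\le j\le k$. Call $\mathfrak{L}$ solvable if $\mathfrak{L}^{(n)}=0$ for some $n\ge 0$, where $\mathfrak{L}^{(0)}=\mathfrak{L}$ and $\mathfrak{L}^{(n+1)}$ is the $\mathbb{F}$-linear span of all products $xy$ with $x,y\in\mathfrak{L}^{(n)}$. Then $\mathfrak{L}$ is supersolvable if, and only if, $\mathfrak{L}$ is solvable and every maximal subalgebra $\mathfrak{M}$ of $\mathfrak{L}$ (that is, every proper subalgebra not contained in a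 strictly larger proper subalgebra) has codimension one, i.e., $\dim_{\mathbb{F}}\mathfrak{L}/\mathfrak{M}=1$. -/

import Mathlib

/-- A (not necessarily associative) algebra is a left Leibniz algebra if every left
multiplication operator is a derivation. The underlying `F`-algebra structure is given by
`NonUnitalNonAssocRing L`, `Module F L`, `IsScalarTower F L L` and `SMulCommClass F L L`,
which together say that the multiplication is `F`-bilinear. -/
class IsLeftLeibniz (L : Type*) [NonUnitalNonAssocRing L] : Prop where
  leibniz : ∀ x y z : L, x * (y * z) = (x * y) * z + y * (x * z)

namespace LeftLeibniz

section

variable (F L : Type*) [Field F] [NonUnitalNonAssocRing L] [Module F L]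

variable {F L} in
/-- A subspace that is a two-sided ideal. -/
def IsIdeal (I : Submodule F L) : Prop :=
  ∀ x : L, ∀ a ∈ I, x * a ∈ I ∧ a * x ∈ I

/-- The derived series: `L⁽⁰⁾ = L` and `L⁽ⁿ⁺¹⁾ = L⁽ⁿ⁾ L⁽ⁿ⁾`, the span of all products. -/
def derivedSeries : ℕ → Submodule F L
  | 0 => ⊤
  | n + 1 => Submodule.span F
      {z | ∃ x ∈ derivedSeries n, ∃ y ∈ derivedSeries n, x * y = z}

/-- `L` is solvable if some term of its derived series vanishes. -/
def IsSolvable : Prop :=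
  ∃ n : ℕ, derivedSeries F L n = ⊥

/-- `L` is supersolvable if there is a chain `0 = L₀ ⊆ L₁ ⊆ ⋯ ⊆ Lₖ = L` of two-sided ideals
of `L` all of whose successive quotients are one-dimensional (the values of `S` beyond `k`
are irrelevant). -/
def IsSupersolvable : Prop :=
  ∃ (k : ℕ) (S : ℕ → Submodule F L),
    S 0 = ⊥ ∧ S k = ⊤ ∧
    (∀ j ≤ k, IsIdeal (S j)) ∧
    ∀ j < k, S j ≤ S (j + 1) ∧
      Module.finrank F (S (j + 1) ⧸ (S j).submoduleOf (S (j + 1))) = 1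

end

end LeftLeibniz

namespace LeftLeibniz

section

variable {F L : Type*} [Field F] [NonUnitalNonAssocRing L] [Module F L]

/-! Supersolvable implies the rest: the first flag term outside a maximal subalgebra `M` together
with `M` spans the algebra, and the preceding term lies in `M`, so `M` has codimension one.
Solvability holds because one-dimensional factors have zero product. Conversely, a flag is grown
downward from the top: below an ideal `I` already reached, each chief factor `I/J` must be a line
(`IsChiefFactor.finrank_eq`). If all products kill `I/J`, eigenspaces are submodules, so
irreducibility forces scalar actions and dimension one. Otherwise some `n` in the derived algebra
acts bijectively on `I/J`, yet nilpotently on `L/I` because of the flag. The Fitting null component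
of `n` modulo `J` is a proper subalgebra that together with `I` spans `L`. A maximal subalgebra
containing it meets `I` exactly in `J`, so its codimension, one, is the dimension of `I/J`. -/

/-- `J` and `I` are consecutive in the lattice of two-sided ideals. -/
structure IsChiefFactor (J I : Submodule F L) : Prop where
  isIdeal_left : IsIdeal J
  isIdeal_right : IsIdeal I
  lt : J < I
  eq_or_eq : ∀ K : Submodule F L, IsIdeal K → J ≤ K → K ≤ I → K = J ∨ K = I

/-- There is a chain of ideals with one-dimensional factors leading from `J` to the top. -/
def HasFlagAbove (J : Submodule F L) : Prop :=
  ∃ (k : ℕ) (S : ℕ → Submodule F L), S 0 = J ∧ S k = ⊤ ∧ (∀ j ≤ k, IsIdeal (S j)) ∧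
    ∀ j < k, S j ≤ S (j + 1) ∧ Module.finrank F (S (j + 1)) = Module.finrank F (S j) + 1

theorem finrank_quotient_submoduleOf_eq_one_iff [FiniteDimensional F L] {J I : Submodule F L}
    (h : J ≤ I) :
    Module.finrank F (I ⧸ J.submoduleOf I) = 1 ↔
      Module.finrank F I = Module.finrank F J + 1 := by
  have h1 := (J.submoduleOf I).finrank_quotient_add_finrank
  have h2 : Module.finrank F (J.submoduleOf I) = Module.finrank F J :=
    (Submodule.submoduleOfEquivOfLe h).finrank_eq
  omega

theorem isSupersolvable_iff_hasFlagAbove_bot [FiniteDimensional F L] :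
    IsSupersolvable F L ↔ HasFlagAbove (⊥ : Submodule F L) := by
  constructor
  · rintro ⟨k, S, h0, hk, hI, hS⟩
    exact ⟨k, S, h0, hk, hI, fun j hj => ⟨(hS j hj).1,
      (finrank_quotient_submoduleOf_eq_one_iff (hS j hj).1).1 (hS j hj).2⟩⟩
  · rintro ⟨k, S, h0, hk, hI, hS⟩
    exact ⟨k, S, h0, hk, hI, fun j hj => ⟨(hS j hj).1,
      (finrank_quotient_submoduleOf_eq_one_iff (hS j hj).1).2 (hS j hj).2⟩⟩

theorem HasFlagAbove.cons {J I : Submodule F L} (h : HasFlagAbove I) (hJ : IsIdeal J)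
    (hJI : J ≤ I) (hr : Module.finrank F I = Module.finrank F J + 1) : HasFlagAbove J := by
  obtain ⟨k, S, rfl, hk, hI, hS⟩ := h
  refine ⟨k + 1, fun n => Nat.casesOn n J S, rfl, hk, ?_, ?_⟩
  · rintro (_ | j) hj
    · exact hJ
    · exact hI j (by omega)
  · rintro (_ | j) hj
    · exact ⟨hJI, hr⟩
    · exact hS j (by omega)

theorem sup_span_singleton_eq_of_finrank [FiniteDimensional F L] {J I : Submodule F L}
    (h : J ≤ I) (hr : Module.finrank F I = Module.finrank F J + 1) {e : L} (he : e ∈ I)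
    (heJ : e ∉ J) : J ⊔ Submodule.span F {e} = I := by
  have hle : J ⊔ Submodule.span F {e} ≤ I :=
    sup_le h ((Submodule.span_singleton_le_iff_mem _ _).2 he)
  refine Submodule.eq_of_le_of_finrank_le hle ?_
  have hlt : J < J ⊔ Submodule.span F {e} := by
    refine lt_of_le_of_ne le_sup_left fun hEq => heJ ?_
    rw [hEq]
    exact Submodule.mem_sup_right (Submodule.mem_span_singleton_self e)
  have := Submodule.finrank_lt_finrank_of_lt hlt
  omega

theorem exists_sub_smul_mem_of_finrank [FiniteDimensional F L] {J I : Submodule F L}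
    (h : J ≤ I) (hr : Module.finrank F I = Module.finrank F J + 1) {e : L} (he : e ∈ I)
    (heJ : e ∉ J) {v : L} (hv : v ∈ I) : ∃ c : F, v - c • e ∈ J := by
  rw [← sup_span_singleton_eq_of_finrank h hr he heJ, Submodule.mem_sup] at hv
  obtain ⟨s, hs, t, ht, rfl⟩ := hv
  obtain ⟨c, rfl⟩ := Submodule.mem_span_singleton.1 ht
  exact ⟨c, by simpa using hs⟩

theorem finrank_eq_add_one_of_sup_span_singleton [FiniteDimensional F L] {J I : Submodule F L}
    (hlt : J < I) {e : L} (h : J ⊔ Submodule.span F {e} = I) :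
    Module.finrank F I = Module.finrank F J + 1 := by
  have h1 := Submodule.finrank_add_le_finrank_add_finrank J (Submodule.span F {e})
  have h2 := finrank_span_le_card (R := F) ({e} : Set L)
  have h3 := Submodule.finrank_lt_finrank_of_lt hlt
  simp only [Set.toFinset_singleton, Finset.card_singleton] at h2
  rw [h] at h1
  omega

/-! ### Ideals, maximal subalgebras, and codimension one from a flag -/

variable [IsScalarTower F L L] [SMulCommClass F L L]

theorem isIdeal_span {s : Set L}
    (h : ∀ x : L, ∀ a ∈ s, x * a ∈ Submodule.span F s ∧ a * x ∈ Submodule.span F s) :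
    IsIdeal (Submodule.span F s) := by
  intro x a ha
  induction ha using Submodule.span_induction with
  | mem a ha => exact h x a ha
  | zero => simp
  | add a b _ _ iha ihb =>
    rw [mul_add, add_mul]
    exact ⟨add_mem iha.1 ihb.1, add_mem iha.2 ihb.2⟩
  | smul c a _ iha =>
    rw [mul_smul_comm, smul_mul_assoc]
    exact ⟨Submodule.smul_mem _ c iha.1, Submodule.smul_mem _ c iha.2⟩

omit [IsScalarTower F L L] [SMulCommClass F L L] in
theorem IsIdeal.sup {I J : Submodule F L} (hI : IsIdeal I) (hJ : IsIdeal J) :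
    IsIdeal (I ⊔ J) := by
  intro x a ha
  obtain ⟨s, hs, t, ht, rfl⟩ := Submodule.mem_sup.1 ha
  rw [mul_add, add_mul]
  exact ⟨Submodule.add_mem_sup (hI x s hs).1 (hJ x t ht).1,
    Submodule.add_mem_sup (hI x s hs).2 (hJ x t ht).2⟩

/-- The sum of a subalgebra and an ideal is a subalgebra. -/
def supIdeal (M : NonUnitalSubalgebra F L) (I : Submodule F L) (hI : IsIdeal I) :
    NonUnitalSubalgebra F L :=
  { M.toSubmodule ⊔ I with
    mul_mem' := by
      intro a b ha hb
      obtain ⟨m, hm, i, hi, rfl⟩ := Submodule.mem_sup.1 ha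
      obtain ⟨m', hm', i', hi', rfl⟩ := Submodule.mem_sup.1 hb
      have : (m + i) * (m' + i') = m * m' + (m * i' + i * (m' + i')) := by
        rw [add_mul, mul_add, add_assoc]
      rw [this]
      exact Submodule.add_mem_sup (M.mul_mem hm hm') (add_mem (hI _ _ hi').1 (hI _ _ hi).2) }

theorem sup_eq_top_of_isCoatom {M : NonUnitalSubalgebra F L} (hM : IsCoatom M)
    {I : Submodule F L} (hI : IsIdeal I) (hIM : ¬ I ≤ M.toSubmodule) :
    M.toSubmodule ⊔ I = ⊤ := by
  have hlt : M < supIdeal M I hI := by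
    refine lt_of_le_of_ne (fun x hx => ?_) fun h => hIM fun x hx => ?_
    · exact Submodule.mem_sup_left (S := M.toSubmodule) hx
    · have : x ∈ supIdeal M I hI := Submodule.mem_sup_right (T := I) hx
      rwa [← h] at this
  rw [eq_top_iff]
  intro x _
  have : x ∈ supIdeal M I hI := by rw [hM.2 _ hlt]; trivial
  exact this

theorem finrank_quotient_eq_one_of_flag [FiniteDimensional F L]
    (h : HasFlagAbove (⊥ : Submodule F L)) {M : NonUnitalSubalgebra F L} (hM : IsCoatom M) :
    Module.finrank F (L ⧸ M.toSubmodule) = 1 := by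
  classical
  obtain ⟨k, S, h0, hk, hI, hS⟩ := h
  have hne : ¬ (⊤ : Submodule F L) ≤ M.toSubmodule := fun h =>
    hM.1 (eq_top_iff.2 fun x _ => h (Submodule.mem_top (x := x)))
  have hex : ∃ j, j ≤ k ∧ ¬ S j ≤ M.toSubmodule := ⟨k, le_rfl, hk ▸ hne⟩
  -- The first flag term outside `M`; its predecessor lies in `M`.
  obtain ⟨hjk, hj⟩ := Nat.find_spec hex
  rcases hfind : Nat.find hex with _ | j
  · rw [hfind, h0] at hj
    exact absurd bot_le hj
  rw [hfind] at hj hjk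
  have hjM : S j ≤ M.toSubmodule := by
    by_contra hc
    exact Nat.find_min hex (by omega) ⟨by omega, hc⟩
  have htop := sup_eq_top_of_isCoatom hM (hI _ hjk) hj
  have h1 := Submodule.finrank_sup_add_finrank_inf_eq M.toSubmodule (S (j + 1))
  rw [htop, finrank_top] at h1
  have h2 := Submodule.finrank_mono (le_inf hjM (hS j hjk).1)
  have h3 := (hS j hjk).2
  have h4 := M.toSubmodule.finrank_quotient_add_finrank
  have h5 : Module.finrank F M.toSubmodule < Module.finrank F L :=
    Submodule.finrank_lt fun h => hne h.ge
  omega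

/-! ### One-dimensional factors and solvability -/

variable [IsLeftLeibniz L]

omit F [Field F] [Module F L] [IsScalarTower F L L] [SMulCommClass F L L] in
theorem mul_mul_eq_sub (x y z : L) : (x * y) * z = x * (y * z) - y * (x * z) := by
  rw [IsLeftLeibniz.leibniz x y z, add_sub_cancel_right]

omit F [Field F] [Module F L] [IsScalarTower F L L] [SMulCommClass F L L] in
theorem add_swap_mul_eq_zero (x y z : L) : (x * y + y * x) * z = 0 := by
  rw [add_mul, mul_mul_eq_sub, mul_mul_eq_sub, sub_add_sub_cancel, sub_self]

theorem mul_mem_of_finrank_eq_add_one [FiniteDimensional F L] {J I : Submodule F L}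
    (hJ : IsIdeal J) (hI : IsIdeal I) (h : J ≤ I)
    (hr : Module.finrank F I = Module.finrank F J + 1) {x y : L} (hx : x ∈ I) (hy : y ∈ I) :
    x * y ∈ J := by
  by_cases hxJ : x ∈ J
  · exact (hJ y x hxJ).2
  obtain ⟨c, hc⟩ := exists_sub_smul_mem_of_finrank h hr hx hxJ hy
  obtain ⟨d, hd⟩ := exists_sub_smul_mem_of_finrank h hr hx hxJ (hI x x hx).1
  have hxx : x * x ∈ J := by
    -- Squares annihilate from the left, so if `x * x` is `d • x` modulo `J`, then `d • (x * x)`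
    -- lies in `J`.
    have h1 : (x * x) * x = 0 := by rw [mul_mul_eq_sub, sub_self]
    have h2 := (hJ x _ hd).2
    rw [sub_mul, h1, zero_sub, smul_mul_assoc, Submodule.neg_mem_iff] at h2
    by_cases hd0 : d = 0
    · simpa [hd0] using hd
    · exact (Submodule.smul_mem_iff _ hd0).1 h2
  have h3 := (hJ x _ hc).1
  rw [mul_sub, mul_smul_comm] at h3
  exact (Submodule.sub_mem_iff_left _ (Submodule.smul_mem _ c hxx)).1 h3

theorem isSolvable_of_flag [FiniteDimensional F L] (h : HasFlagAbove (⊥ : Submodule F L)) :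
    IsSolvable F L := by
  obtain ⟨k, S, h0, hk, hI, hS⟩ := h
  have key : ∀ n ≤ k, derivedSeries F L n ≤ S (k - n) := by
    intro n
    induction n with
    | zero => intro _; rw [Nat.sub_zero, hk]; exact le_top
    | succ n ih =>
      intro hn
      refine Submodule.span_le.2 ?_
      rintro _ ⟨x, hx, y, hy, rfl⟩
      have hkn : k - n = k - (n + 1) + 1 := by omega
      have hle := ih (by omega)
      rw [hkn] at hle
      exact mul_mem_of_finrank_eq_add_one (hI _ (by omega)) (hI _ (by omega))
        (hS _ (by omega)).1 (hS _ (by omega)).2 (hle hx) (hle hy)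
  refine ⟨k, eq_bot_iff.2 ?_⟩
  have := key k le_rfl
  rwa [Nat.sub_self, h0] at this

/-- A product acts as the commutator of two left multiplications, and scalars on a line commute. -/
theorem mul_mul_mem_of_finrank_eq_add_one [FiniteDimensional F L] {J I : Submodule F L}
    (hJ : IsIdeal J) (hI : IsIdeal I) (h : J ≤ I)
    (hr : Module.finrank F I = Module.finrank F J + 1) {n v : L}
    (hn : n ∈ derivedSeries F L 1) (hv : v ∈ I) : n * v ∈ J := by
  induction hn using Submodule.span_induction with
  | mem n hn =>
    obtain ⟨x, -, y, -, rfl⟩ := hn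
    by_cases hvJ : v ∈ J
    · exact (hJ _ v hvJ).1
    obtain ⟨a, ha⟩ := exists_sub_smul_mem_of_finrank h hr hv hvJ (hI x v hv).1
    obtain ⟨b, hb⟩ := exists_sub_smul_mem_of_finrank h hr hv hvJ (hI y v hv).1
    have : (x * y) * v = x * (y * v - b • v) - y * (x * v - a • v)
        + b • (x * v - a • v) - a • (y * v - b • v) := by
      rw [mul_mul_eq_sub]
      simp only [mul_sub, mul_smul_comm, smul_sub, smul_smul, mul_comm b a]
      abel
    rw [this]
    exact sub_mem (add_mem (sub_mem (hJ _ _ hb).1 (hJ _ _ ha).1) (Submodule.smul_mem _ _ ha))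
      (Submodule.smul_mem _ _ hb)
  | zero => simp
  | add a b _ _ iha ihb => rw [add_mul]; exact add_mem iha ihb
  | smul c a _ iha => rw [smul_mul_assoc]; exact Submodule.smul_mem _ c iha

omit [IsScalarTower F L L] [SMulCommClass F L L] [IsLeftLeibniz L] in
theorem mul_mem_derivedSeries_one (x n : L) : x * n ∈ derivedSeries F L 1 :=
  Submodule.subset_span ⟨x, trivial, n, trivial, rfl⟩

theorem isIdeal_span_mul {I : Submodule F L} (hI : IsIdeal I) :
    IsIdeal (Submodule.span F {z | ∃ x ∈ I, ∃ y ∈ I, x * y = z}) := by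
  refine isIdeal_span ?_
  rintro x _ ⟨a, ha, b, hb, rfl⟩
  constructor
  · rw [IsLeftLeibniz.leibniz x a b]
    exact add_mem (Submodule.subset_span ⟨_, (hI x a ha).1, b, hb, rfl⟩)
      (Submodule.subset_span ⟨a, ha, _, (hI x b hb).1, rfl⟩)
  · rw [mul_mul_eq_sub]
    exact sub_mem (Submodule.subset_span ⟨a, ha, _, (hI x b hb).2, rfl⟩)
      (Submodule.subset_span ⟨b, hb, _, (hI x a ha).2, rfl⟩)

/-! ### Chief factors of a solvable algebra -/

namespace IsChiefFactor

variable {J I : Submodule F L}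

theorem mul_mem (h : IsChiefFactor J I) (hs : IsSolvable F L) {a b : L} (ha : a ∈ I)
    (hb : b ∈ I) : a * b ∈ J := by
  set K : Submodule F L := Submodule.span F {z | ∃ x ∈ I, ∃ y ∈ I, x * y = z} with hK
  have hKI : K ≤ I := Submodule.span_le.2 (by
    rintro _ ⟨x, -, y, hy, rfl⟩
    exact (h.isIdeal_right x y hy).1)
  rcases h.eq_or_eq (K ⊔ J) ((isIdeal_span_mul h.isIdeal_right).sup h.isIdeal_left)
    le_sup_right (sup_le hKI h.lt.le) with h1 | h1
  · rw [← h1]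
    exact Submodule.mem_sup_left (Submodule.subset_span ⟨a, ha, b, hb, rfl⟩)
  -- If `I` equals its square modulo `J`, it survives in every derived term modulo `J`,
  -- contradicting solvability.
  · have key : ∀ n, I ≤ derivedSeries F L n ⊔ J := by
      intro n
      induction n with
      | zero => exact le_sup_of_le_left le_top
      | succ n ih =>
        rw [← h1]
        refine sup_le (Submodule.span_le.2 ?_) le_sup_right
        rintro _ ⟨x, hx, y, hy, rfl⟩
        obtain ⟨s, hs, t, ht, rfl⟩ := Submodule.mem_sup.1 (ih hx)
        obtain ⟨s', hs', t', ht', rfl⟩ := Submodule.mem_sup.1 (ih hy)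
        have : (s + t) * (s' + t') = s * s' + (s * t' + t * (s' + t')) := by
          rw [add_mul, mul_add, add_assoc]
        rw [this]
        exact Submodule.add_mem_sup (Submodule.subset_span ⟨s, hs, s', hs', rfl⟩)
          (add_mem (h.isIdeal_left _ _ ht').1 (h.isIdeal_left _ _ ht).2)
    obtain ⟨n, hn⟩ := hs
    have := key n
    rw [hn, bot_sup_eq] at this
    exact absurd this h.lt.not_ge

/-- The right action on a chief factor is either zero or the negative of the left action. -/
theorem add_swap_mem_or_mul_mem (h : IsChiefFactor J I) :
    (∀ x : L, ∀ a ∈ I, x * a + a * x ∈ J) ∨ ∀ x : L, ∀ a ∈ I, a * x ∈ J := by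
  -- Symmetrized products annihilate `L` from the left; their span is an ideal, so modulo `J` it is
  -- zero or all of `I`.
  set K : Submodule F L := Submodule.span F {z | ∃ x : L, ∃ a ∈ I, x * a + a * x = z} with hK
  have hmul : ∀ y : L, ∀ z ∈ K, z * y = 0 := by
    intro y z hz
    induction hz using Submodule.span_induction with
    | mem z hz =>
      obtain ⟨x, a, -, rfl⟩ := hz
      exact add_swap_mul_eq_zero x a y
    | zero => simp
    | add a b _ _ iha ihb => rw [add_mul, iha, ihb, add_zero]
    | smul c a _ iha => rw [smul_mul_assoc, iha, smul_zero]
  have hKid : IsIdeal K := by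
    refine isIdeal_span ?_
    rintro y _ ⟨x, a, ha, rfl⟩
    constructor
    · have : y * (x * a + a * x)
          = ((y * x) * a + a * (y * x)) + (x * (y * a) + (y * a) * x) := by
        rw [mul_add, IsLeftLeibniz.leibniz y x a, IsLeftLeibniz.leibniz y a x]
        abel
      rw [this]
      exact add_mem (Submodule.subset_span ⟨_, a, ha, rfl⟩)
        (Submodule.subset_span ⟨x, _, (h.isIdeal_right y a ha).1, rfl⟩)
    · rw [add_swap_mul_eq_zero]
      exact zero_mem _
  have hKI : K ≤ I := Submodule.span_le.2 (by
    rintro _ ⟨x, a, ha, rfl⟩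
    exact add_mem (h.isIdeal_right x a ha).1 (h.isIdeal_right x a ha).2)
  rcases h.eq_or_eq (K ⊔ J) (hKid.sup h.isIdeal_left) le_sup_right (sup_le hKI h.lt.le)
    with h1 | h1
  · left
    intro x a ha
    rw [← h1]
    exact Submodule.mem_sup_left (Submodule.subset_span ⟨x, a, ha, rfl⟩)
  · right
    intro x a ha
    rw [← h1] at ha
    obtain ⟨s, hs, t, ht, rfl⟩ := Submodule.mem_sup.1 ha
    rw [add_mul, hmul x s hs, zero_add]
    exact (h.isIdeal_left x t ht).2

/-- A chief factor is irreducible as a left module. -/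
theorem eq_or_eq_of_left (h : IsChiefFactor J I) {W : Submodule F L} (hJW : J ≤ W)
    (hWI : W ≤ I) (hW : ∀ x : L, ∀ a ∈ W, x * a ∈ W) : W = J ∨ W = I := by
  refine h.eq_or_eq W (fun x a ha => ⟨hW x a ha, ?_⟩) hJW hWI
  rcases h.add_swap_mem_or_mul_mem with h1 | h1
  · exact (Submodule.add_mem_iff_right _ (hW x a ha)).1 (hJW (h1 x a (hWI ha)))
  · exact hJW (h1 x a (hWI ha))

/-- Left multiplication on a chief factor. -/
def leftAction (h : IsChiefFactor J I) (x : L) : Module.End F (I ⧸ J.submoduleOf I) :=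
  (J.submoduleOf I).mapQ (J.submoduleOf I)
    ((LinearMap.mulLeft F x).restrict fun a ha => (h.isIdeal_right x a ha).1)
    fun a ha => (h.isIdeal_left x a ha).1

omit [IsScalarTower F L L] [SMulCommClass F L L] [IsLeftLeibniz L] in
theorem exists_notMem (h : IsChiefFactor J I) : ∃ a ∈ I, a ∉ J :=
  SetLike.exists_of_lt h.lt

omit [IsScalarTower F L L] [IsLeftLeibniz L] in
theorem exists_eigenvector [IsAlgClosed F] [FiniteDimensional F L] (h : IsChiefFactor J I)
    (x : L) : ∃ c : F, ∃ a ∈ I, a ∉ J ∧ x * a - c • a ∈ J := by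
  have : Nontrivial (I ⧸ J.submoduleOf I) := by
    rw [Submodule.Quotient.nontrivial_iff]
    intro hEq
    obtain ⟨a, ha, haJ⟩ := h.exists_notMem
    exact haJ (show (⟨a, ha⟩ : I) ∈ J.submoduleOf I from hEq ▸ Submodule.mem_top)
  obtain ⟨c, hc⟩ := Module.End.exists_eigenvalue (h.leftAction x)
  obtain ⟨v, hv⟩ := hc.exists_hasEigenvector
  obtain ⟨a, rfl⟩ := Submodule.Quotient.mk_surjective _ v
  refine ⟨c, a, a.2, fun ha => hv.2 ((Submodule.Quotient.mk_eq_zero _).2 ha), ?_⟩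
  have h1 := hv.apply_eq_smul
  rw [← Submodule.Quotient.mk_smul] at h1
  exact (Submodule.Quotient.eq (J.submoduleOf I)).1 h1

omit [IsScalarTower F L L] [IsLeftLeibniz L] in
theorem exists_mul_sub_mem [FiniteDimensional F L] (h : IsChiefFactor J I) {n : L}
    (hn : ∀ a ∈ I, n * a ∈ J → a ∈ J) {a : L} (ha : a ∈ I) : ∃ b ∈ I, n * b - a ∈ J := by
  have hinj : Function.Injective (h.leftAction n) := by
    rw [← LinearMap.ker_eq_bot, LinearMap.ker_eq_bot']
    intro v hv
    obtain ⟨b, rfl⟩ := Submodule.Quotient.mk_surjective _ v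
    exact (Submodule.Quotient.mk_eq_zero _).2
      (hn b b.2 ((Submodule.Quotient.mk_eq_zero (J.submoduleOf I)).1 hv))
  obtain ⟨v, hv⟩ := LinearMap.injective_iff_surjective.1 hinj
    (Submodule.Quotient.mk (⟨a, ha⟩ : I))
  obtain ⟨b, rfl⟩ := Submodule.Quotient.mk_surjective _ v
  exact ⟨b, b.2, (Submodule.Quotient.eq (J.submoduleOf I)).1 hv⟩

/-- A chief factor centralized by all products is one-dimensional. -/
theorem finrank_eq_of_forall_mul_mul_mem [IsAlgClosed F] [FiniteDimensional F L]
    (h : IsChiefFactor J I) (hc : ∀ x y : L, ∀ a ∈ I, (x * y) * a ∈ J) :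
    Module.finrank F I = Module.finrank F J + 1 := by
  have hscalar : ∀ x : L, ∃ c : F, ∀ a ∈ I, x * a - c • a ∈ J := by
    intro x
    obtain ⟨c, a, ha, haJ, hac⟩ := h.exists_eigenvector x
    let f : L →ₗ[F] L := LinearMap.mulLeft F x - c • LinearMap.id
    have hf : ∀ b, f b = x * b - c • b := fun b => rfl
    -- The eigenspace of `x` modulo `J` is left-stable, as `x * y` kills the factor.
    rcases h.eq_or_eq_of_left (W := I ⊓ J.comap f)
      (le_inf h.lt.le fun b hb => by
        rw [Submodule.mem_comap, hf]
        exact sub_mem (h.isIdeal_left x b hb).1 (Submodule.smul_mem _ c hb)) inf_le_left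
      (fun y b hb => by
        obtain ⟨hbI, hbJ⟩ := hb
        refine ⟨(h.isIdeal_right y b hbI).1, ?_⟩
        have hbJ' : x * b - c • b ∈ J := hbJ
        have : f (y * b) = (x * y) * b + y * (x * b - c • b) := by
          rw [hf, IsLeftLeibniz.leibniz x y b, mul_sub, mul_smul_comm]
          abel
        rw [SetLike.mem_coe, Submodule.mem_comap, this]
        exact add_mem (hc x y b hbI) (h.isIdeal_left y _ hbJ').1) with h1 | h1
    · exact absurd (h1 ▸ (⟨ha, hac⟩ : a ∈ I ⊓ J.comap f)) haJ
    · refine ⟨c, fun b hb => ?_⟩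
      rw [← h1] at hb
      exact hb.2
  obtain ⟨a, ha, haJ⟩ := h.exists_notMem
  have haW : a ∈ J ⊔ Submodule.span F {a} :=
    Submodule.mem_sup_right (Submodule.mem_span_singleton_self a)
  have hWI : J ⊔ Submodule.span F {a} ≤ I :=
    sup_le h.lt.le ((Submodule.span_singleton_le_iff_mem _ _).2 ha)
  refine finrank_eq_add_one_of_sup_span_singleton h.lt (e := a) ?_
  refine (h.eq_or_eq_of_left le_sup_left hWI fun x b hb => ?_).resolve_left
    fun h1 => haJ (h1 ▸ haW)
  obtain ⟨c, hxc⟩ := hscalar x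
  have h2 := add_mem (Submodule.mem_sup_left (T := Submodule.span F {a}) (hxc b (hWI hb)))
    (Submodule.smul_mem _ c hb)
  rwa [sub_add_cancel] at h2

/-- A chief factor avoided by a maximal subalgebra of codimension one is one-dimensional. -/
theorem finrank_eq_of_isCoatom [FiniteDimensional F L] (h : IsChiefFactor J I)
    (hs : IsSolvable F L) {M : NonUnitalSubalgebra F L} (hM : IsCoatom M)
    (hM1 : Module.finrank F (L ⧸ M.toSubmodule) = 1) (hJM : J ≤ M.toSubmodule)
    (hIM : ¬ I ≤ M.toSubmodule) : Module.finrank F I = Module.finrank F J + 1 := by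
  have htop := sup_eq_top_of_isCoatom hM h.isIdeal_right hIM
  have hinf : M.toSubmodule ⊓ I = J := by
    refine (h.eq_or_eq_of_left (le_inf hJM h.lt.le) inf_le_right ?_).resolve_right
      fun h1 => hIM (inf_eq_right.1 h1)
    rintro x a ⟨haM, haI⟩
    refine ⟨?_, (h.isIdeal_right x a haI).1⟩
    obtain ⟨m, hm, i, hi, rfl⟩ := Submodule.mem_sup.1 (htop ▸ Submodule.mem_top (x := x))
    rw [add_mul]
    exact add_mem (M.mul_mem hm haM) (hJM (h.mul_mem hs hi haI))
  have h1 := Submodule.finrank_sup_add_finrank_inf_eq M.toSubmodule I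
  rw [htop, finrank_top, hinf] at h1
  have h2 := M.toSubmodule.finrank_quotient_add_finrank
  omega

end IsChiefFactor

/-! ### Fitting null components -/

omit [IsScalarTower F L L] in
-- Leibniz rule for powers of a derivation: each application falls on one of the two factors. The
-- induction on `s` avoids binomial sums.
theorem iterate_mulLeft_mul_mem {J : Submodule F L} (hJ : IsIdeal J) (n : L) (s : ℕ) :
    ∀ (p q : ℕ) (x y : L), p + q ≤ s → ((LinearMap.mulLeft F n) ^ p) x ∈ J →
      ((LinearMap.mulLeft F n) ^ q) y ∈ J → ((LinearMap.mulLeft F n) ^ s) (x * y) ∈ J := by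
  have hstable : ∀ (m : ℕ) (z : L), z ∈ J → ((LinearMap.mulLeft F n) ^ m) z ∈ J := by
    intro m
    induction m with
    | zero => intro z hz; exact hz
    | succ m ih => intro z hz; rw [pow_succ]; exact ih _ (hJ n z hz).1
  induction s with
  | zero =>
    intro p q x y hpq hx _
    obtain rfl : p = 0 := by omega
    exact (hJ y x hx).2
  | succ s ih =>
    intro p q x y hpq hx hy
    obtain _ | p := p
    · exact hstable _ _ (hJ y x hx).2
    obtain _ | q := q
    · exact hstable _ _ (hJ x y hy).1
    have hxy : ((LinearMap.mulLeft F n) ^ (s + 1)) (x * y)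
        = ((LinearMap.mulLeft F n) ^ s) ((n * x) * y)
          + ((LinearMap.mulLeft F n) ^ s) (x * (n * y)) := by
      rw [pow_succ, Module.End.mul_apply, LinearMap.mulLeft_apply,
        IsLeftLeibniz.leibniz n x y, map_add]
    rw [hxy]
    rw [pow_succ] at hx hy
    refine add_mem (ih p (q + 1) _ _ (by omega) hx (by rwa [pow_succ]))
      (ih (p + 1) q _ _ (by omega) (by rwa [pow_succ]) hy)

omit [IsScalarTower F L L] [IsLeftLeibniz L] in
theorem iterate_mulLeft_mem {J : Submodule F L} (hJ : IsIdeal J) (n : L) {p m : ℕ}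
    (hpm : p ≤ m) {x : L} (hx : ((LinearMap.mulLeft F n) ^ p) x ∈ J) :
    ((LinearMap.mulLeft F n) ^ m) x ∈ J := by
  induction m, hpm using Nat.le_induction with
  | base => exact hx
  | succ m _ ih => rw [pow_succ']; exact (hJ n _ ih).1

/-- The Fitting null component of left multiplication by `n`, modulo the ideal `J`. -/
def fittingNull (J : Submodule F L) (hJ : IsIdeal J) (n : L) : NonUnitalSubalgebra F L where
  carrier := {x | ∃ m : ℕ, ((LinearMap.mulLeft F n) ^ m) x ∈ J}
  add_mem' := by
    rintro x y ⟨p, hp⟩ ⟨q, hq⟩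
    refine ⟨max p q, ?_⟩
    rw [map_add]
    exact add_mem (iterate_mulLeft_mem hJ n (le_max_left _ _) hp)
      (iterate_mulLeft_mem hJ n (le_max_right _ _) hq)
  zero_mem' := ⟨0, by simp⟩
  mul_mem' := by
    rintro x y ⟨p, hp⟩ ⟨q, hq⟩
    exact ⟨p + q, iterate_mulLeft_mul_mem hJ n _ p q x y le_rfl hp hq⟩
  smul_mem' := by
    rintro c x ⟨p, hp⟩
    exact ⟨p, by rw [map_smul]; exact Submodule.smul_mem _ c hp⟩

omit [IsLeftLeibniz L] in
theorem exists_isCoatom_ge [FiniteDimensional F L] {M : NonUnitalSubalgebra F L} (hM : M ≠ ⊤) :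
    ∃ N : NonUnitalSubalgebra F L, IsCoatom N ∧ M ≤ N := by
  have hmono : StrictMono
      (NonUnitalSubalgebra.toSubmodule : NonUnitalSubalgebra F L → Submodule F L) :=
    fun A B hAB => lt_of_le_of_ne hAB.le fun h =>
      hAB.ne (NonUnitalSubalgebra.toSubmodule_injective h)
  have : WellFoundedGT (NonUnitalSubalgebra F L) := hmono.wellFoundedGT
  exact (eq_top_or_exists_le_coatom M).resolve_left hM

/-! ### The non-central case -/

namespace IsChiefFactor

variable {J I : Submodule F L}

/-- In the non-central case, some product-element acts injectively on the chief factor. -/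
theorem exists_injective_of_flag [FiniteDimensional F L] (h : IsChiefFactor J I)
    (hs : IsSolvable F L) (hI : HasFlagAbove I)
    (hc : ¬ ∀ x y : L, ∀ a ∈ I, (x * y) * a ∈ J) :
    ∃ n ∈ derivedSeries F L 1, ∀ a ∈ I, n * a ∈ J → a ∈ J := by
  classical
  obtain ⟨k, S, h0, hk, hid, hS⟩ := hI
  have hex : ∃ j, j ≤ k ∧ ∃ n ∈ S j, n ∈ derivedSeries F L 1 ∧ ∃ a ∈ I, n * a ∉ J := by
    push Not at hc
    obtain ⟨x, y, a, ha, hxy⟩ := hc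
    exact ⟨k, le_rfl, x * y, hk ▸ Submodule.mem_top, mul_mem_derivedSeries_one x y, a, ha, hxy⟩
  -- `n` is taken from the lowest possible flag term; that term is not `I`, which acts as zero on
  -- `I/J`.
  obtain ⟨hjk, n, hnS, hnD, a, ha, hna⟩ := Nat.find_spec hex
  rcases hfind : Nat.find hex with _ | j
  · rw [hfind, h0] at hnS
    exact absurd (h.mul_mem hs hnS ha) hna
  rw [hfind] at hnS hjk
  have hcent : ∀ s ∈ S j, s ∈ derivedSeries F L 1 → ∀ b ∈ I, s * b ∈ J := by
    intro s hsS hsD b hb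
    by_contra hsb
    exact Nat.find_min hex (m := j) (by omega) ⟨by omega, s, hsS, hsD, b, hb, hsb⟩
  have hnj : n ∉ S j := fun hn => hna (hcent n hn hnD a ha)
  refine ⟨n, hnD, ?_⟩
  -- The kernel of `n` is a submodule: `x * n` is a multiple of `n` up to an element of `S j` that
  -- is still in the derived algebra, hence acts as zero.
  have hker : I ⊓ J.comap (LinearMap.mulLeft F n) = J := by
    refine (h.eq_or_eq_of_left
      (le_inf h.lt.le fun b hb => (h.isIdeal_left n b hb).1) inf_le_left ?_).resolve_right
      fun h1 => hna (h1.ge ha).2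
    rintro x b ⟨hbI, hbJ⟩
    have hbJ' : n * b ∈ J := hbJ
    refine ⟨(h.isIdeal_right x b hbI).1, ?_⟩
    obtain ⟨c, hxc⟩ := exists_sub_smul_mem_of_finrank (hS j hjk).1 (hS j hjk).2 hnS hnj
      (hid _ hjk x n hnS).1
    have hsb := hcent _ hxc
      (sub_mem (mul_mem_derivedSeries_one x n) (Submodule.smul_mem _ c hnD)) b hbI
    have : n * (x * b) = x * (n * b) - c • (n * b) - (x * n - c • n) * b := by
      rw [IsLeftLeibniz.leibniz x n b, sub_mul, smul_mul_assoc]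
      abel
    show n * (x * b) ∈ J
    rw [this]
    exact sub_mem (sub_mem (h.isIdeal_left x _ hbJ').1 (Submodule.smul_mem _ c hbJ')) hsb
  exact fun b hb hnb => hker.le ⟨hb, hnb⟩

omit [IsScalarTower F L L] [IsLeftLeibniz L] in
theorem exists_iterate_sub_mem [FiniteDimensional F L] (h : IsChiefFactor J I) {n : L}
    (hn : ∀ a ∈ I, n * a ∈ J → a ∈ J) (m : ℕ) :
    ∀ a ∈ I, ∃ b ∈ I, ((LinearMap.mulLeft F n) ^ m) b - a ∈ J := by
  induction m with
  | zero => exact fun a ha => ⟨a, ha, by simp⟩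
  | succ m ih =>
    intro a ha
    obtain ⟨b, hb, hba⟩ := h.exists_mul_sub_mem hn ha
    obtain ⟨d, hd, hdb⟩ := ih b hb
    refine ⟨d, hd, ?_⟩
    rw [pow_succ', Module.End.mul_apply, LinearMap.mulLeft_apply]
    have h1 := add_mem (h.isIdeal_left n _ hdb).1 hba
    rwa [mul_sub, sub_add_sub_cancel] at h1

omit [IsScalarTower F L L] [IsLeftLeibniz L] in
theorem mem_of_iterate_mem (h : IsChiefFactor J I) {n : L}
    (hn : ∀ a ∈ I, n * a ∈ J → a ∈ J) (m : ℕ) :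
    ∀ a ∈ I, ((LinearMap.mulLeft F n) ^ m) a ∈ J → a ∈ J := by
  induction m with
  | zero => exact fun a _ ha => ha
  | succ m ih =>
    intro a ha hm
    rw [pow_succ] at hm
    exact hn a ha (ih _ (h.isIdeal_right n a ha).1 hm)

end IsChiefFactor

/-- Derived elements kill each line of the flag, so every application of `n` descends one term. -/
theorem exists_iterate_mem_of_flag [FiniteDimensional F L] {I : Submodule F L}
    (hI : HasFlagAbove I) {n : L} (hn : n ∈ derivedSeries F L 1) :
    ∃ m : ℕ, ∀ x : L, ((LinearMap.mulLeft F n) ^ m) x ∈ I := by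
  obtain ⟨k, S, rfl, hk, hid, hS⟩ := hI
  have key : ∀ m ≤ k, ∀ x : L, ((LinearMap.mulLeft F n) ^ m) x ∈ S (k - m) := by
    intro m
    induction m with
    | zero => intro _ x; rw [Nat.sub_zero, hk]; trivial
    | succ m ih =>
      intro hm x
      have hkm : k - m = k - (m + 1) + 1 := by omega
      have hx := ih (by omega) x
      rw [hkm] at hx
      rw [pow_succ']
      exact mul_mul_mem_of_finrank_eq_add_one (hid _ (by omega)) (hid _ (by omega))
        (hS _ (by omega)).1 (hS _ (by omega)).2 hn hx
  exact ⟨k, fun x => by simpa using key k le_rfl x⟩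

theorem IsChiefFactor.finrank_eq [IsAlgClosed F] [FiniteDimensional F L] {J I : Submodule F L}
    (h : IsChiefFactor J I) (hs : IsSolvable F L)
    (hM : ∀ M : NonUnitalSubalgebra F L, IsCoatom M →
      Module.finrank F (L ⧸ M.toSubmodule) = 1)
    (hI : HasFlagAbove I) : Module.finrank F I = Module.finrank F J + 1 := by
  by_cases hc : ∀ x y : L, ∀ a ∈ I, (x * y) * a ∈ J
  · exact h.finrank_eq_of_forall_mul_mul_mem hc
  obtain ⟨n, hnD, hn⟩ := h.exists_injective_of_flag hs hI hc
  obtain ⟨m, hm⟩ := exists_iterate_mem_of_flag hI hnD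
  obtain ⟨a, ha, haJ⟩ := h.exists_notMem
  have hne : fittingNull J h.isIdeal_left n ≠ ⊤ := by
    intro htop
    obtain ⟨p, hp⟩ : a ∈ fittingNull J h.isIdeal_left n := htop ▸ trivial
    exact haJ (h.mem_of_iterate_mem hn p a ha hp)
  obtain ⟨M, hMc, hle⟩ := exists_isCoatom_ge hne
  refine h.finrank_eq_of_isCoatom hs hMc (hM M hMc) (fun x hx => hle ⟨0, hx⟩) fun hIM => ?_
  refine hMc.1 (eq_top_iff.2 fun x _ => ?_)
  -- Fitting decomposition: `b` in `I` has the same `m`-th iterate as `x` modulo `J`, so `b - x` is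
  -- in the null component.
  obtain ⟨b, hb, hbx⟩ := h.exists_iterate_sub_mem hn m _ (hm x)
  have hbx' : b - x ∈ M := hle ⟨m, by rwa [map_sub]⟩
  simpa using sub_mem (show b ∈ M from hIM hb) hbx'

/-! ### Descent along chief factors -/

omit [IsScalarTower F L L] [SMulCommClass F L L] [IsLeftLeibniz L] in
theorem exists_isChiefFactor [FiniteDimensional F L] {I : Submodule F L} (hI : IsIdeal I)
    (hne : I ≠ ⊥) : ∃ J : Submodule F L, IsChiefFactor J I := by
  have hbot : IsIdeal (⊥ : Submodule F L) := by
    intro x a ha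
    rw [(Submodule.mem_bot F).1 ha]
    simp
  obtain ⟨J, ⟨hJ, hJI⟩, hmax⟩ := WellFounded.has_min (wellFounded_gt (α := Submodule F L))
    {J | IsIdeal J ∧ J < I} ⟨⊥, hbot, bot_lt_iff_ne_bot.2 hne⟩
  refine ⟨J, hJ, hI, hJI, fun K hK hJK hKI => ?_⟩
  by_contra! hcon
  exact hmax K ⟨hK, lt_of_le_of_ne hKI hcon.2⟩ (lt_of_le_of_ne hJK hcon.1.symm)

theorem hasFlagAbove_bot [IsAlgClosed F] [FiniteDimensional F L] (hs : IsSolvable F L)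
    (hM : ∀ M : NonUnitalSubalgebra F L, IsCoatom M →
      Module.finrank F (L ⧸ M.toSubmodule) = 1) :
    HasFlagAbove (⊥ : Submodule F L) := by
  have htop : IsIdeal (⊤ : Submodule F L) := fun _ _ _ => ⟨trivial, trivial⟩
  -- A minimal ideal with a flag above it; the length-zero flag at the top shows that one exists.
  obtain ⟨I, ⟨hI, hflag⟩, hmin⟩ := WellFounded.has_min (wellFounded_lt (α := Submodule F L))
    {I | IsIdeal I ∧ HasFlagAbove I}
    ⟨⊤, htop, 0, fun _ => ⊤, rfl, rfl, fun _ _ => htop, fun _ h => absurd h (by omega)⟩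
  by_cases hne : I = ⊥
  · exact hne ▸ hflag
  obtain ⟨J, hJ⟩ := exists_isChiefFactor hI hne
  exact absurd hJ.lt (hmin J ⟨hJ.isIdeal_left,
    hflag.cons hJ.isIdeal_left hJ.lt.le (hJ.finrank_eq hs hM hflag)⟩)

end

end LeftLeibniz

theorem corollary5p2 {F : Type*} [Field F] [IsAlgClosed F]
    {L : Type*} [NonUnitalNonAssocRing L] [Module F L] [IsScalarTower F L L]
    [SMulCommClass F L L] [IsLeftLeibniz L] [FiniteDimensional F L] :
    LeftLeibniz.IsSupersolvable F L ↔
      LeftLeibniz.IsSolvable F L ∧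
        ∀ M : NonUnitalSubalgebra F L, IsCoatom M →
          Module.finrank F (L ⧸ M.toSubmodule) = 1 := by
  rw [LeftLeibniz.isSupersolvable_iff_hasFlagAbove_bot]
  exact ⟨fun h => ⟨LeftLeibniz.isSolvable_of_flag h,
    fun _ hM => LeftLeibniz.finrank_quotient_eq_one_of_flag h hM⟩,
    fun h => LeftLeibniz.hasFlagAbove_bot h.1 h.2⟩
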